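/- For a metric space $X$ and $\delta>0$ let $N_\delta(X)$ be the maximum number of pairwise disjoint open balls of radius $\delta$ in $X$, and let $$\overline{\dim}\,X=\limsup_{\delta\to 0^+}\frac{-\log N_\delta(X)}{\log\delta}$$ be the upper Minkowski dimension of $X$. Let $K=\mathbb{R}$ or $K=\mathbb{Q}_p$ for a prime $p$, and let $G$ be a compact Lie group over $K$ (smooth if $K=\mathbb R$, analytic if $K=\mathbb{Q}_p$) of dimension $n=\dim G$. A metric $d$ on $G$ (inducing the topology of $G$) is called compatible if it is left- and right-invariant and there is a coordinate map from an open neighborhood of the identity $e$ of $G$ onto an open subset of $K^n$ which is bi-Lipschitz on some neighborhood of $e$. **Theorem.** Let $G$ be a compact real or $p$-adic Lie group, endowed with a compatible metric. Then there is a subset $X\subseteq G$ such that $X^2=\{xy : x,y\in X\}=G$ and $\overline{\dim}\,X=\tfrac12\dim G$, where $X$ carries the restricted metric. -/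

import Mathlib

open scoped Topology Manifold ContDiff Pointwise ENNReal

/-- The `δ`-packing number of a metric space `X`: the maximum number of pairwise disjoint open
balls of radius `δ` in `X` (counted by their centers; `⊤` if there is no maximum).
The balls are balls of the space `X` itself. -/
noncomputable def ballPackingNumber (X : Type*) [MetricSpace X] (δ : ℝ) : ℕ∞ :=
  ⨆ (s : Set X) (_ : s.PairwiseDisjoint fun x => Metric.ball x δ), s.encard

/-- The upper Minkowski dimension `limsup_{δ → 0⁺} (- log N_δ(X)) / log δ` of a metric space `X`,
with values in the extended reals. -/
noncomputable def upperMinkowskiDim (X : Type*) [MetricSpace X] : EReal :=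
  Filter.limsup
    (fun δ : ℝ => -(ENNReal.log (ballPackingNumber X δ : ℝ≥0∞)) / ((Real.log δ : ℝ) : EReal))
    (𝓝[>] 0)

/-- The metric of a Lie group `G` of class `C^m` over `𝕜`, modelled on `E`, is compatible if it is
left- and right-invariant and some coordinate map `φ` of `G` at the identity (a chart of the
maximal `C^m` atlas) is bi-Lipschitz on some neighborhood of the identity. -/
structure IsCompatibleMetric (𝕜 E G : Type*) [NontriviallyNormedField 𝕜]
    [NormedAddCommGroup E] [NormedSpace 𝕜 E] [Group G] [MetricSpace G] [ChartedSpace E G]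
    (m : ℕ∞ω) : Prop where
  left_invariant : ∀ g x y : G, dist (g * x) (g * y) = dist x y
  right_invariant : ∀ g x y : G, dist (x * g) (y * g) = dist x y
  biLipschitz_chart : ∃ φ ∈ IsManifold.maximalAtlas 𝓘(𝕜, E) m G, (1 : G) ∈ φ.source ∧
    ∃ V ∈ 𝓝 (1 : G), V ⊆ φ.source ∧ ∃ C : ℝ, ∀ x ∈ V, ∀ y ∈ V,
      dist (φ x) (φ y) ≤ C * dist x y ∧ dist x y ≤ C * dist (φ x) (φ y)

/-! Write `n` for the dimension. If `X * X` is all of `G`, products of the centres of a maximal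
packing of `X` come within a multiple of `δ` of every element. So the square of the packing number
is at least of order `δ⁻ⁿ`, which forces dimension at least `n / 2`
(`card_le_ballPackingNumber_sq`).

For equality, each `g` is expanded as `a * b`, with corrections at finer and finer scales shared
evenly between `a` and `b` (`exists_mul_eq_of_nets`). Round `m` refines first `a`, then `b`, each by
a factor `q ^ (2 * m + 1)` in scale, choosing from at most `A * q ^ (n * (2 * m + 1))` net points.
Since the first `m` odd numbers sum to `m ^ 2`, after `m` rounds each factor is near one of at most
`D * A ^ m * q ^ (n * m ^ 2)` points, at scale about `q⁻¹ ^ (2 * m ^ 2)`. Quadratic exponents serve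
two ends: `A ^ m` is negligible against `q ^ (n * m ^ 2)`, and the logarithms of consecutive scales
have ratio tending to 1, so intermediate `δ` do not raise the limsup. -/

/-! ### Nets and separated sets in the model spaces. -/

/-- The normed group `E` has, up to constants, the same nets and separated sets at the scales
`q⁻¹ ^ a` as an `n`-dimensional space over `ℝ` or (for `q = p`) over `ℚ_[p]`. -/
structure IsGridded (E : Type*) [SeminormedAddCommGroup E] (q n : ℕ) : Prop where
  exists_net : ∃ A : ℕ, ∀ a k : ℕ, ∃ F : Finset E, F.card ≤ A * q ^ (n * k) ∧
    ∀ x : E, ‖x‖ ≤ (q : ℝ)⁻¹ ^ a → ∃ y ∈ F, ‖x - y‖ ≤ (q : ℝ)⁻¹ ^ (a + k)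
  exists_separated : ∀ a k : ℕ, ∃ F : Finset E, q ^ (n * k) ≤ F.card ∧
    (∀ x ∈ F, ‖x‖ ≤ (q : ℝ)⁻¹ ^ a) ∧ ∀ x ∈ F, ∀ y ∈ F, x ≠ y → (q : ℝ)⁻¹ ^ (a + k) ≤ ‖x - y‖

theorem isGridded_real : IsGridded ℝ 2 1 where
  exists_net := by
    classical
    -- The constant 3 comes from `2 * 2 ^ k + 1 ≤ 3 * 2 ^ k`.
    refine ⟨3, fun a k => ⟨(Finset.Icc (-2 ^ k : ℤ) (2 ^ k)).image
      fun j : ℤ => (j : ℝ) * (2 : ℝ)⁻¹ ^ (a + k), ?_, fun x hx => ?_⟩⟩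
    · refine Finset.card_image_le.trans ?_
      have := Nat.one_le_two_pow (n := k)
      rw [Int.card_Icc]
      have h : ((2 : ℤ) ^ k + 1 - (-2 ^ k)) = ((2 * 2 ^ k + 1 : ℕ) : ℤ) := by push_cast; ring
      rw [h, Int.toNat_natCast, one_mul]
      omega
    · have hp : (0 : ℝ) < 2⁻¹ ^ (a + k) := by positivity
      have hpp : (2 : ℝ)⁻¹ ^ (a + k) * 2 ^ (a + k) = 1 := by rw [← mul_pow]; norm_num
      have hx' : |x * 2 ^ (a + k)| ≤ 2 ^ k := by
        rw [abs_mul, abs_of_pos (by positivity : (0 : ℝ) < 2 ^ (a + k))]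
        calc |x| * 2 ^ (a + k) ≤ (2 : ℝ)⁻¹ ^ a * 2 ^ (a + k) := by gcongr; simpa using hx
          _ = 2 ^ k := by rw [pow_add, ← mul_assoc, ← mul_pow]; norm_num
      rw [abs_le] at hx'
      refine ⟨_, Finset.mem_image_of_mem _ (a := ⌊x * 2 ^ (a + k)⌋) (Finset.mem_Icc.2
        ⟨Int.le_floor.2 (by push_cast; exact hx'.1), ?_⟩), ?_⟩
      · exact_mod_cast (Int.floor_le _).trans hx'.2
      · have h1 := Int.floor_le (x * 2 ^ (a + k))
        have h2 := (Int.lt_floor_add_one (x * 2 ^ (a + k))).le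
        have : x - ⌊x * 2 ^ (a + k)⌋ * (2 : ℝ)⁻¹ ^ (a + k)
            = (x * 2 ^ (a + k) - ⌊x * 2 ^ (a + k)⌋) * (2 : ℝ)⁻¹ ^ (a + k) := by
          linear_combination (-x) * hpp
        push_cast
        rw [this, norm_mul, Real.norm_eq_abs, Real.norm_eq_abs, abs_of_pos hp]
        refine mul_le_of_le_one_left hp.le (abs_le.2 ⟨?_, ?_⟩) <;> linarith
  exists_separated := by
    classical
    intro a k
    have hp : (0 : ℝ) < 2⁻¹ ^ (a + k) := by positivity
    refine ⟨(Finset.range (2 ^ k)).image fun j : ℕ => (j : ℝ) * (2 : ℝ)⁻¹ ^ (a + k), ?_, ?_, ?_⟩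
    · rw [Finset.card_image_of_injective, Finset.card_range, one_mul]
      intro i j h
      exact_mod_cast mul_right_cancel₀ hp.ne' h
    · simp only [Finset.mem_image, Finset.mem_range, forall_exists_index, and_imp]
      rintro _ j hj rfl
      have hj' : (j : ℝ) ≤ 2 ^ k := by exact_mod_cast hj.le
      rw [Real.norm_of_nonneg (by positivity)]
      calc (j : ℝ) * 2⁻¹ ^ (a + k) ≤ 2 ^ k * 2⁻¹ ^ (a + k) := by gcongr
        _ = 2⁻¹ ^ a * (2 * 2⁻¹) ^ k := by rw [mul_pow, pow_add]; ring
        _ = _ := by norm_num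
    · simp only [Finset.mem_image, Finset.mem_range, forall_exists_index, and_imp]
      rintro _ i - rfl _ j - rfl hne
      have hij : (i : ℤ) - j ≠ 0 := by
        intro h
        have : i = j := by omega
        exact hne (by rw [this])
      have h1 : (1 : ℝ) ≤ |(i : ℝ) - j| := by exact_mod_cast Int.one_le_abs hij
      push_cast
      rw [← sub_mul, norm_mul, Real.norm_of_nonneg hp.le, Real.norm_eq_abs]
      exact le_mul_of_one_le_left hp.le h1

/-- The integers below `p ^ k` represent the residues of `ℤ_[p]` modulo `p ^ k` exactly once. Scaled
by `p ^ a`, they are both the net and the separated set. -/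
theorem isGridded_padic (p : ℕ) [hp : Fact p.Prime] : IsGridded ℚ_[p] p 1 where
  exists_net := by
    classical
    have hp0 : (p : ℚ_[p]) ≠ 0 := by exact_mod_cast hp.out.ne_zero
    refine ⟨1, fun a k => ⟨(Finset.range (p ^ k)).image fun j : ℕ => (p : ℚ_[p]) ^ a * j, ?_, ?_⟩⟩
    · simpa using Finset.card_image_le (s := Finset.range (p ^ k))
        (f := fun j : ℕ => (p : ℚ_[p]) ^ a * j)
    · intro x hx
      have hy : ‖x / (p : ℚ_[p]) ^ a‖ ≤ 1 := by
        rw [norm_div, norm_pow, Padic.norm_p]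
        exact div_le_one_of_le₀ hx (by positivity)
      let y : ℤ_[p] := ⟨x / (p : ℚ_[p]) ^ a, hy⟩
      refine ⟨_, Finset.mem_image_of_mem _ (Finset.mem_range.2 (y.appr_lt k)), ?_⟩
      have h := y.appr_spec k
      rw [← PadicInt.norm_le_pow_iff_mem_span_pow] at h
      have hx' : x = (p : ℚ_[p]) ^ a * (y : ℚ_[p]) := by
        simp only [y]; field_simp
      have h2 : ‖(y : ℚ_[p]) - (y.appr k : ℕ)‖ ≤ (p : ℝ)⁻¹ ^ k := by
        have : ((y - (y.appr k : ℕ) : ℤ_[p]) : ℚ_[p]) = (y : ℚ_[p]) - (y.appr k : ℕ) := by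
          push_cast; rfl
        rw [← this, ← PadicInt.norm_def]
        simpa [zpow_neg] using h
      have : x - (p : ℚ_[p]) ^ a * (y.appr k : ℕ)
          = (p : ℚ_[p]) ^ a * ((y : ℚ_[p]) - (y.appr k : ℕ)) := by rw [hx']; ring
      rw [this, norm_mul, norm_pow, Padic.norm_p, pow_add]
      gcongr
  exists_separated := by
    classical
    intro a k
    have hp0 : (p : ℚ_[p]) ≠ 0 := by exact_mod_cast hp.out.ne_zero
    refine ⟨(Finset.range (p ^ k)).image fun j : ℕ => (p : ℚ_[p]) ^ a * j, ?_, ?_, ?_⟩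
    · rw [Finset.card_image_of_injective, Finset.card_range, one_mul]
      intro i j h
      exact_mod_cast mul_left_cancel₀ (pow_ne_zero a hp0) h
    · simp only [Finset.mem_image, Finset.mem_range, forall_exists_index, and_imp]
      rintro _ j - rfl
      rw [norm_mul, norm_pow, Padic.norm_p]
      refine mul_le_of_le_one_right (by positivity) ?_
      exact_mod_cast Padic.norm_int_le_one (p := p) (j : ℤ)
    · simp only [Finset.mem_image, Finset.mem_range, forall_exists_index, and_imp]
      rintro _ i hi rfl _ j hj rfl hne
      rw [← mul_sub, norm_mul, norm_pow, Padic.norm_p, pow_add]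
      gcongr
      by_contra! h
      have h' : ‖((i - j : ℤ) : ℚ_[p])‖ ≤ (p : ℝ) ^ (-k : ℤ) := by
        push_cast; simpa [zpow_neg] using h.le
      rw [Padic.norm_int_le_pow_iff_dvd] at h'
      have h0 : (i - j : ℤ) = 0 := by
        refine Int.eq_zero_of_abs_lt_dvd h' ?_
        have h1 : (i : ℤ) < (p : ℤ) ^ k := by exact_mod_cast hi
        have h2 : (j : ℤ) < (p : ℤ) ^ k := by exact_mod_cast hj
        rw [abs_lt]; constructor <;> omega
      exact hne (by rw [show i = j by omega])

theorem IsGridded.pi {E : Type*} [SeminormedAddCommGroup E] {q : ℕ} (h : IsGridded E q 1)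
    (n : ℕ) : IsGridded (Fin n → E) q n where
  exists_net := by
    classical
    obtain ⟨A, hA⟩ := h.exists_net
    refine ⟨A ^ n, fun a k => ?_⟩
    obtain ⟨F, hF, hFx⟩ := hA a k
    refine ⟨Fintype.piFinset fun _ => F, ?_, fun x hx => ?_⟩
    · rw [Fintype.card_piFinset_const, mul_comm n k, pow_mul, ← mul_pow]
      simpa using Nat.pow_le_pow_left hF n
    · rw [pi_norm_le_iff_of_nonneg (by positivity)] at hx
      choose y hy hxy using fun i => hFx (x i) (hx i)
      exact ⟨y, by simpa using hy, (pi_norm_le_iff_of_nonneg (by positivity)).2 hxy⟩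
  exists_separated := by
    classical
    intro a k
    obtain ⟨F, hF, hFa, hFs⟩ := h.exists_separated a k
    refine ⟨Fintype.piFinset fun _ => F, ?_, fun x hx => ?_, fun x hx y hy hne => ?_⟩
    · rw [Fintype.card_piFinset_const, mul_comm n k, pow_mul]
      simpa using Nat.pow_le_pow_left hF n
    · rw [Fintype.mem_piFinset] at hx
      exact (pi_norm_le_iff_of_nonneg (by positivity)).2 fun i => hFa _ (hx i)
    · rw [Fintype.mem_piFinset] at hx hy
      obtain ⟨i, hi⟩ := Function.ne_iff.1 hne
      exact (hFs _ (hx i) _ (hy i) hi).trans (norm_le_pi_norm (x - y) i)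

/-! ### Transfer to the group through a bi-Lipschitz chart. -/

/-- The metric space `X` has, near the point `x₀` and up to constants, the same nets and separated
sets at the scales `q⁻¹ ^ a` as an `n`-dimensional space over `ℝ` or (for `q = p`) over `ℚ_[p]`. -/
structure IsGriddedAt (X : Type*) [MetricSpace X] (x₀ : X) (q n : ℕ) : Prop where
  exists_net : ∃ A M : ℕ, ∀ a k : ℕ, M ≤ a → ∃ F : Finset X, F.card ≤ A * q ^ (n * k) ∧
    (∀ y ∈ F, dist y x₀ ≤ (q : ℝ)⁻¹ ^ a) ∧
    ∀ x : X, dist x x₀ ≤ (q : ℝ)⁻¹ ^ a → ∃ y ∈ F, dist x y ≤ (q : ℝ)⁻¹ ^ (a + k)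
  exists_separated : ∃ M : ℕ, ∀ k : ℕ, ∃ F : Finset X, q ^ (n * k) ≤ F.card ∧
    ∀ x ∈ F, ∀ y ∈ F, x ≠ y → (q : ℝ)⁻¹ ^ (M + k) ≤ dist x y

theorem exists_closedBall_inv_pow_subset {X : Type*} [PseudoMetricSpace X] {x : X} {s : Set X}
    (hs : s ∈ 𝓝 x) {q : ℕ} (hq : 1 < q) : ∃ M : ℕ, Metric.closedBall x ((q : ℝ)⁻¹ ^ M) ⊆ s := by
  obtain ⟨ε, hε, h⟩ := Metric.nhds_basis_closedBall.mem_iff.1 hs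
  obtain ⟨M, hM⟩ := exists_pow_lt_of_lt_one hε
    (inv_lt_one_of_one_lt₀ (by exact_mod_cast hq : (1 : ℝ) < q))
  exact ⟨M, (Metric.closedBall_subset_closedBall hM.le).trans h⟩

theorem IsGridded.isGriddedAt {E X : Type*} [SeminormedAddCommGroup E] [MetricSpace X] {q n : ℕ}
    (h : IsGridded E q n) (hq : 1 < q) {x₀ : X} {ψ : X → E} {V : Set X} (hV : V ∈ 𝓝 x₀)
    (hψV : ψ '' V ∈ 𝓝 (ψ x₀)) {C : ℝ}
    (hC : ∀ x ∈ V, ∀ y ∈ V, dist (ψ x) (ψ y) ≤ C * dist x y ∧ dist x y ≤ C * dist (ψ x) (ψ y)) :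
    IsGriddedAt X x₀ q n := by
  classical
  have hq1 : (1 : ℝ) < q := by exact_mod_cast hq
  have hq0 : (0 : ℝ) < q := by positivity
  -- Distortion by `C` costs at most `l` scales; the 2 pays for comparing two points of one cell.
  obtain ⟨l, hl⟩ := pow_unbounded_of_one_lt (2 * C) hq1
  have hl0 : (0 : ℝ) < (q : ℝ) ^ l := by positivity
  have hCl : C ≤ (q : ℝ) ^ l := by linarith
  have hql : ∀ m : ℕ, (q : ℝ) ^ l * (q : ℝ)⁻¹ ^ (m + l) = (q : ℝ)⁻¹ ^ m := by
    intro m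
    rw [pow_add, mul_left_comm, ← mul_pow, mul_inv_cancel₀ hq0.ne', one_pow, mul_one]
  obtain ⟨M₀, hM₀⟩ := exists_closedBall_inv_pow_subset hV hq
  obtain ⟨M₁, hM₁⟩ := exists_closedBall_inv_pow_subset hψV hq
  constructor
  · obtain ⟨A, hA⟩ := h.exists_net
    refine ⟨A * q ^ (n * (l + l)), M₀ + l, fun a k ha => ?_⟩
    obtain ⟨b, rfl⟩ : ∃ b, a = b + l := ⟨a - l, by omega⟩
    obtain ⟨F, hF, hFx⟩ := hA b (k + (l + l))
    have hsub : ∀ x, dist x x₀ ≤ (q : ℝ)⁻¹ ^ (b + l) → x ∈ V := fun x hx =>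
      hM₀ (hx.trans (pow_le_pow_of_le_one (by positivity) (inv_le_one_of_one_le₀ hq1.le)
        (by omega)))
    -- Net points of `E` need not lie in the image of the ball, so each is replaced by some point of
    -- the ball mapped close to it, if there is one.
    let P : E → X → Prop := fun y x => dist x x₀ ≤ (q : ℝ)⁻¹ ^ (b + l) ∧
      ‖ψ x - ψ x₀ - y‖ ≤ (q : ℝ)⁻¹ ^ (b + l + k + l)
    let g : E → X := fun y => if hy : ∃ x, P y x then hy.choose else x₀
    have hg : ∀ y, (∃ x, P y x) → P y (g y) := fun y hy => by
      simp only [g, dif_pos hy]; exact hy.choose_spec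
    refine ⟨(F.filter fun y => ∃ x, P y x).image g, ?_, ?_, fun x hx => ?_⟩
    · calc _ ≤ F.card := Finset.card_image_le.trans (Finset.card_filter_le _ _)
        _ ≤ A * q ^ (n * (k + (l + l))) := hF
        _ = _ := by rw [mul_add, pow_add]; ring
    · simp only [Finset.mem_image, Finset.mem_filter, forall_exists_index, and_imp]
      rintro _ y - x hx rfl
      exact (hg y ⟨x, hx⟩).1
    · have hd : ‖ψ x - ψ x₀‖ ≤ (q : ℝ)⁻¹ ^ b := by
        rw [← dist_eq_norm]
        calc _ ≤ C * dist x x₀ := (hC x (hsub x hx) x₀ (mem_of_mem_nhds hV)).1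
          _ ≤ (q : ℝ) ^ l * (q : ℝ)⁻¹ ^ (b + l) := by gcongr
          _ = _ := hql b
      obtain ⟨y, hy, hxy⟩ := hFx _ hd
      have hPx : P y x := ⟨hx, hxy.trans_eq (by congr 1; ring)⟩
      have hPg := hg y ⟨x, hPx⟩
      refine ⟨g y, Finset.mem_image_of_mem g (Finset.mem_filter.2 ⟨hy, x, hPx⟩), ?_⟩
      have h2 : dist (ψ x) (ψ (g y)) ≤ 2 * (q : ℝ)⁻¹ ^ (b + l + k + l) := by
        rw [dist_eq_norm, show ψ x - ψ (g y)
          = (ψ x - ψ x₀ - y) - (ψ (g y) - ψ x₀ - y) by abel]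
        exact (norm_sub_le _ _).trans (by linarith [hPx.2, hPg.2])
      have h3 := (hC x (hsub x hx) _ (hsub _ hPg.1)).2
      rcases le_or_gt C 0 with hC0 | hC0
      · exact h3.trans ((mul_nonpos_of_nonpos_of_nonneg hC0 dist_nonneg).trans (by positivity))
      · calc _ ≤ C * (2 * (q : ℝ)⁻¹ ^ (b + l + k + l)) := h3.trans (by gcongr)
          _ = (2 * C) * (q : ℝ)⁻¹ ^ (b + l + k + l) := by ring
          _ ≤ (q : ℝ) ^ l * (q : ℝ)⁻¹ ^ (b + l + k + l) := by gcongr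
          _ = _ := hql _
  · refine ⟨M₁ + l, fun k => ?_⟩
    obtain ⟨F, hF, hFa, hFs⟩ := h.exists_separated M₁ k
    have hex : ∀ y : F, ∃ x ∈ V, ψ x = ψ x₀ + y := fun y =>
      hM₁ (by simpa [dist_eq_norm] using hFa y y.2)
    choose g hgV hg using hex
    have hd : ∀ y z : F, y ≠ z → (q : ℝ)⁻¹ ^ (M₁ + l + k) ≤ dist (g y) (g z) := by
      intro y z hyz
      have h1 := hFs y y.2 z z.2 (fun e => hyz (Subtype.ext e))
      have h2 := (hC _ (hgV y) _ (hgV z)).1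
      rw [hg, hg, dist_eq_norm, add_sub_add_left_eq_sub] at h2
      refine le_of_mul_le_mul_left ?_ hl0
      calc _ = (q : ℝ)⁻¹ ^ (M₁ + k) := by rw [← hql (M₁ + k)]; congr 2; ring
        _ ≤ C * dist (g y) (g z) := h1.trans h2
        _ ≤ _ := by gcongr
    have hinj : Function.Injective g := by
      intro y z hyz
      by_contra hne
      have := hd y z hne
      rw [hyz, dist_self] at this
      exact absurd this (not_le.2 (by positivity))
    refine ⟨Finset.univ.image g, ?_, ?_⟩
    · rwa [Finset.card_image_of_injective _ hinj, Finset.card_univ, Fintype.card_coe]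
    · simp only [Finset.mem_image, Finset.mem_univ, true_and, forall_exists_index]
      rintro _ y rfl _ z rfl hne
      exact hd y z fun e => hne (by rw [e])

theorem IsCompatibleMetric.isGriddedAt {K E G : Type*} [NontriviallyNormedField K]
    [CompleteSpace K] [NormedAddCommGroup E] [NormedSpace K E] [FiniteDimensional K E] [Group G]
    [MetricSpace G] [ChartedSpace E G] {m : ℕ∞ω} (h : IsCompatibleMetric K E G m) {q : ℕ}
    (hq : 1 < q) (hK : IsGridded K q 1) : IsGriddedAt G 1 q (Module.finrank K E) := by
  obtain ⟨φ, -, h1, V, hV, -, C, hC⟩ := h.biLipschitz_chart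
  let e : E ≃L[K] (Fin (Module.finrank K E) → K) :=
    ContinuousLinearEquiv.ofFinrankEq (by simp)
  obtain ⟨B, hB⟩ : ∃ B : ℝ, 1 ≤ B ∧ ∀ x y, dist (e x) (e y) ≤ B * dist x y ∧
      dist x y ≤ B * dist (e x) (e y) := by
    refine ⟨max 1 (max ‖(e : E →L[K] (Fin (Module.finrank K E) → K))‖
      ‖(e.symm : (Fin (Module.finrank K E) → K) →L[K] E)‖), le_max_left _ _,
      fun x y => ⟨?_, ?_⟩⟩
    · rw [dist_eq_norm, dist_eq_norm, ← map_sub]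
      refine ((e : E →L[K] (Fin (Module.finrank K E) → K)).le_opNorm _).trans ?_
      gcongr
      exact (le_max_left _ _).trans (le_max_right _ _)
    · rw [dist_eq_norm, dist_eq_norm, ← map_sub]
      have := (e.symm : (Fin (Module.finrank K E) → K) →L[K] E).le_opNorm (e (x - y))
      simp only [ContinuousLinearEquiv.coe_coe, ContinuousLinearEquiv.symm_apply_apply] at this
      refine this.trans ?_
      gcongr
      exact (le_max_right _ _).trans (le_max_right _ _)
  refine (hK.pi _).isGriddedAt hq (ψ := fun x => e (φ x)) (C := B * max C 0) hV ?_
    fun x hx y hy => ⟨?_, ?_⟩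
  · have := e.toHomeomorph.isOpenMap.image_mem_nhds (φ.image_mem_nhds h1 hV)
    rwa [Set.image_image] at this
  · have hB0 : 0 ≤ B := zero_le_one.trans hB.1
    calc _ ≤ B * dist (φ x) (φ y) := (hB.2 _ _).1
      _ ≤ B * (max C 0 * dist x y) := by
        gcongr
        exact (hC x hx y hy).1.trans (by gcongr; exact le_max_left _ _)
      _ = _ := by ring
  · calc _ ≤ C * dist (φ x) (φ y) := (hC x hx y hy).2
      _ ≤ max C 0 * (B * dist (e (φ x)) (e (φ y))) := by
        gcongr
        · exact le_max_left _ _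
        · exact (hB.2 _ _).2
      _ = _ := by ring

/-! ### Factorization by successive approximation and construction of `X`. -/

/-- If finite sets `U m` and `W m` contain nets of shrinking balls around `1`, then every element
of `G` is the product of an element close to all the sets `P m`, obtained by multiplying the
`U i`, and one close to all the sets `Q m`, obtained by multiplying the `W i`. -/
theorem exists_mul_eq_of_nets {G : Type*} [Group G] [MetricSpace G] [CompleteSpace G]
    (hl : ∀ g x y : G, dist (g * x) (g * y) = dist x y)
    (hr : ∀ g x y : G, dist (x * g) (y * g) = dist x y)
    {η θ : ℕ → ℝ} (hη : ∀ m, η (m + 1) ≤ η m / 2) (hθ : ∀ m, θ m ≤ η m)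
    {P Q U W : ℕ → Set G}
    (hP : ∀ m, P (m + 1) = P m * U m) (hQ : ∀ m, Q (m + 1) = Q m * W m)
    (hU : ∀ m, ∀ y ∈ U m, dist y 1 ≤ η m) (hW : ∀ m, ∀ y ∈ W m, dist y 1 ≤ θ m)
    (hUn : ∀ m x, dist x 1 ≤ η m → ∃ y ∈ U m, dist x y ≤ θ m)
    (hWn : ∀ m x, dist x 1 ≤ θ m → ∃ y ∈ W m, dist x y ≤ η (m + 1))
    {g : G} (hg : ∃ a ∈ P 0, ∃ b ∈ Q 0, dist (a * b) g ≤ η 0) :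
    ∃ a b, a * b = g ∧ (∀ m, ∃ p ∈ P m, dist a p ≤ 2 * η m) ∧
      ∀ m, ∃ p ∈ Q m, dist b p ≤ 2 * η m := by
  let S : ℕ → Type _ := fun m => {s : G × G // s.1 ∈ P m ∧ s.2 ∈ Q m ∧ dist (s.1 * s.2) g ≤ η m}
  have step : ∀ m (s : S m), ∃ s' : S (m + 1),
      dist s'.1.1 s.1.1 ≤ η m ∧ dist s'.1.2 s.1.2 ≤ η m := by
    rintro m ⟨⟨a, b⟩, ha, hb, hab⟩
    simp only at ha hb hab
    -- The correction `u` is inserted between `a` and `b`; two-sided invariance turns the error of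
    -- `a * b` into the distance of `a⁻¹ * g * b⁻¹` from `1`.
    obtain ⟨u, hu, hu'⟩ := hUn m (a⁻¹ * g * b⁻¹) (by
      rw [← hl a, ← hr b]
      simpa [mul_assoc, dist_comm] using hab)
    have hab' : dist (a * u * b) g ≤ θ m := by
      rw [← hl a, ← hr b] at hu'
      simpa [mul_assoc, dist_comm] using hu'
    obtain ⟨v, hv, hv'⟩ := hWn m ((a * u * b)⁻¹ * g) (by
      rw [← hl (a * u * b), mul_inv_cancel_left, mul_one, dist_comm]
      exact hab')
    rw [← hl (a * u * b), mul_inv_cancel_left] at hv'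
    refine ⟨⟨(a * u, b * v), ?_, ?_, ?_⟩, ?_, ?_⟩
    · rw [hP]; exact Set.mul_mem_mul ha hu
    · rw [hQ]; exact Set.mul_mem_mul hb hv
    · rw [dist_comm, ← mul_assoc]; exact hv'
    · simpa using (hl a u 1).trans_le (hU m u hu)
    · simpa using (hl b v 1).trans_le ((hW m v hv).trans (hθ m))
  choose f hf using step
  obtain ⟨a₀, ha₀, b₀, hb₀, hab₀⟩ := hg
  let s : ∀ m, S m := fun m => Nat.rec ⟨(a₀, b₀), ha₀, hb₀, hab₀⟩ f m
  have hs : ∀ m, dist (s (m + 1)).1.1 (s m).1.1 ≤ η m ∧ dist (s (m + 1)).1.2 (s m).1.2 ≤ η m :=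
    fun m => hf m (s m)
  have hη0 : ∀ m, 0 ≤ η m := fun m => dist_nonneg.trans (hs m).1
  -- The unsimplified form `2 * η 0 / 2 / 2 ^ m` is the one `cauchySeq_of_le_geometric_two` expects.
  have hgeom : ∀ m, η m ≤ 2 * η 0 / 2 / 2 ^ m := by
    intro m
    induction m with
    | zero => simp
    | succ m ih =>
      calc η (m + 1) ≤ η m / 2 := hη m
        _ ≤ (2 * η 0 / 2 / 2 ^ m) / 2 := by gcongr
        _ = _ := by rw [pow_succ]; ring
  have hlim : ∀ x : ℕ → G, (∀ m, dist (x (m + 1)) (x m) ≤ η m) →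
      ∃ a, ∀ m, dist a (x m) ≤ 2 * η m := by
    intro x hx
    have hc : CauchySeq x := cauchySeq_of_le_geometric_two (C := 2 * η 0) fun m => by
      rw [dist_comm]; exact (hx m).trans (hgeom m)
    obtain ⟨a, ha⟩ := cauchySeq_tendsto_of_complete hc
    -- Subtracting `2 * η (m + j)` makes the induction close, because `η` at least halves at each
    -- step.
    have hj : ∀ m j, dist (x (m + j)) (x m) ≤ 2 * η m - 2 * η (m + j) := by
      intro m j
      induction j with
      | zero => simp
      | succ j ih =>
        have h1 := hx (m + j)
        have h2 := hη (m + j)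
        rw [← add_assoc]
        linarith [dist_triangle (x (m + j + 1)) (x (m + j)) (x m)]
    refine ⟨a, fun m => le_of_tendsto ((ha.comp (Filter.tendsto_add_atTop_nat m)).dist
      tendsto_const_nhds) (Filter.Eventually.of_forall fun j => ?_)⟩
    have := hj m j
    rw [add_comm] at this
    simp only [Function.comp]
    linarith [hη0 (j + m)]
  obtain ⟨a, ha⟩ := hlim (fun m => (s m).1.1) fun m => (hs m).1
  obtain ⟨b, hb⟩ := hlim (fun m => (s m).1.2) fun m => (hs m).2
  refine ⟨a, b, ?_, fun m => ⟨_, (s m).2.1, ha m⟩, fun m => ⟨_, (s m).2.2.1, hb m⟩⟩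
  have h5 : ∀ m, dist (a * b) g ≤ 5 * (2 * η 0 / 2 / 2 ^ m) := by
    intro m
    have h1 : dist (a * b) ((s m).1.1 * b) ≤ 2 * η m := (hr _ _ _).trans_le (ha m)
    have h2 : dist ((s m).1.1 * b) ((s m).1.1 * (s m).1.2) ≤ 2 * η m :=
      (hl _ _ _).trans_le (hb m)
    have h3 := (s m).2.2.2
    linarith [hgeom m, dist_triangle4 (a * b) ((s m).1.1 * b) ((s m).1.1 * (s m).1.2) g]
  have ht : Filter.Tendsto (fun m : ℕ => 5 * (2 * η 0 / 2 / 2 ^ m)) Filter.atTop (𝓝 (5 * 0)) :=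
    (tendsto_const_nhds.div_atTop (tendsto_pow_atTop_atTop_of_one_lt one_lt_two)).const_mul 5
  rw [mul_zero] at ht
  exact dist_le_zero.1 (ge_of_tendsto' ht h5)

theorem exists_mul_self_eq_univ_of_isGriddedAt {G : Type*} [Group G] [MetricSpace G]
    [CompactSpace G] (hl : ∀ g x y : G, dist (g * x) (g * y) = dist x y)
    (hr : ∀ g x y : G, dist (x * g) (y * g) = dist x y) {q n : ℕ} (hq : 1 < q)
    (h : IsGriddedAt G 1 q n) :
    ∃ X : Set G, X * X = Set.univ ∧ ∃ A D M : ℕ, ∀ m : ℕ, ∃ T : Finset G,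
      T.card ≤ D * A ^ m * q ^ (n * m ^ 2) ∧
        ∀ x ∈ X, ∃ p ∈ T, dist x p ≤ 2 * (q : ℝ)⁻¹ ^ (M + 2 * m ^ 2) := by
  classical
  have hq1 : (1 : ℝ) < q := by exact_mod_cast hq
  have hq0 : (0 : ℝ) < q := by positivity
  obtain ⟨A, M, hA⟩ := h.exists_net
  choose! F hF hF1 hFn using hA
  obtain ⟨F₀, -, hF₀⟩ := isCompact_univ.finite_cover_balls (X := G)
    (e := (q : ℝ)⁻¹ ^ M) (by positivity)
  obtain ⟨hfin, hF₀⟩ := hF₀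
  -- Two refinements by `2 * m + 1` lead from exponent `M + 2 * m ^ 2` to `M + 2 * (m + 1) ^ 2`.
  let U : ℕ → Finset G := fun m => F (M + 2 * m ^ 2) (2 * m + 1)
  let W : ℕ → Finset G := fun m => F (M + 2 * m ^ 2 + (2 * m + 1)) (2 * m + 1)
  obtain ⟨P, hP0, hP⟩ : ∃ P : ℕ → Finset G, P 0 = hfin.toFinset ∧ ∀ m, P (m + 1) = P m * U m :=
    ⟨fun m => Nat.rec hfin.toFinset (fun m s => s * U m) m, rfl, fun _ => rfl⟩
  obtain ⟨Q, hQ0, hQ⟩ : ∃ Q : ℕ → Finset G, Q 0 = {1} ∧ ∀ m, Q (m + 1) = Q m * W m :=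
    ⟨fun m => Nat.rec {1} (fun m s => s * W m) m, rfl, fun _ => rfl⟩
  have hcard : ∀ (R V : ℕ → Finset G) (D : ℕ), (R 0).card ≤ D → (∀ m, R (m + 1) = R m * V m) →
      (∀ m, (V m).card ≤ A * q ^ (n * (2 * m + 1))) →
      ∀ m, (R m).card ≤ D * A ^ m * q ^ (n * m ^ 2) := by
    intro R V D h0 hs hV m
    induction m with
    | zero => simpa using h0
    | succ m ih =>
      rw [hs]
      calc _ ≤ (R m).card * (V m).card := Finset.card_mul_le
        _ ≤ (D * A ^ m * q ^ (n * m ^ 2)) * (A * q ^ (n * (2 * m + 1))) :=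
          Nat.mul_le_mul ih (hV m)
        _ = _ := by
          rw [show n * (m + 1) ^ 2 = n * m ^ 2 + n * (2 * m + 1) by ring, pow_add]; ring
  have hPc := hcard P U hfin.toFinset.card (by rw [hP0]) hP fun m => hF _ _ (by omega)
  have hQc := hcard Q W 1 (by simp [hQ0]) hQ fun m => hF _ _ (by omega)
  let η : ℕ → ℝ := fun m => (q : ℝ)⁻¹ ^ (M + 2 * m ^ 2)
  -- `X` collects the possible left and right factors together; the union only adds to the constant
  -- `D`.
  refine ⟨{x | ∀ m, ∃ p ∈ P m ∪ Q m, dist x p ≤ 2 * η m}, ?_, A, hfin.toFinset.card + 1, M,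
    fun m => ⟨P m ∪ Q m, ?_, fun x hx => hx m⟩⟩
  · refine Set.eq_univ_of_forall fun g => ?_
    have key := exists_mul_eq_of_nets hl hr (η := η)
      (θ := fun m => (q : ℝ)⁻¹ ^ (M + 2 * m ^ 2 + (2 * m + 1)))
      (P := fun m => (P m : Set G)) (Q := fun m => (Q m : Set G))
      (U := fun m => (U m : Set G)) (W := fun m => (W m : Set G)) (g := g)
      (fun m => ?_) (fun m => ?_) (fun m => ?_) (fun m => ?_) (fun m y hy => ?_)
      (fun m y hy => ?_) (fun m x hx => ?_) (fun m x hx => ?_) ?_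
    · obtain ⟨a, b, hab, ha, hb⟩ := key
      refine Set.mem_mul.2 ⟨a, fun m => ?_, b, fun m => ?_, hab⟩
      · obtain ⟨p, hp, h⟩ := ha m
        exact ⟨p, Finset.mem_union_left _ hp, h⟩
      · obtain ⟨p, hp, h⟩ := hb m
        exact ⟨p, Finset.mem_union_right _ hp, h⟩
    · have h2 : (q : ℝ)⁻¹ ≤ 2⁻¹ := inv_anti₀ two_pos (by exact_mod_cast hq)
      calc η (m + 1) ≤ (q : ℝ)⁻¹ ^ (M + 2 * m ^ 2 + 1) :=
            pow_le_pow_of_le_one (by positivity) (inv_le_one_of_one_le₀ hq1.le) (by ring_nf; omega)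
        _ = η m * (q : ℝ)⁻¹ := pow_succ _ _
        _ ≤ η m / 2 := by rw [div_eq_mul_inv]; gcongr
    · exact pow_le_pow_of_le_one (by positivity) (inv_le_one_of_one_le₀ hq1.le) (by omega)
    · simp only [hP, Finset.coe_mul]
    · simp only [hQ, Finset.coe_mul]
    · exact hF1 _ _ (by omega) y hy
    · exact hF1 _ _ (by omega) y hy
    · exact hFn _ _ (by omega) x hx
    · obtain ⟨y, hy, hxy⟩ := hFn _ (2 * m + 1) (by omega) x hx
      refine ⟨y, hy, hxy.trans_eq ?_⟩
      simp only [η]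
      congr 1; ring
    · obtain ⟨p, hp, hgp⟩ := Set.mem_iUnion₂.1 (hF₀ (Set.mem_univ g))
      refine ⟨p, by simpa [hP0] using hp, 1, by simp [hQ0], ?_⟩
      rw [mul_one, dist_comm]
      exact (Metric.mem_ball.1 hgp).le.trans_eq (by simp [η])
  · calc _ ≤ (P m).card + (Q m).card := Finset.card_union_le _ _
      _ ≤ _ := add_le_add (hPc m) (hQc m)
      _ = _ := by ring

/-! ### Packing numbers, coverings and products. -/

/-- Two centres assigned to the same `p` are less than `δ` apart, so each lies in the other's ball.
-/
theorem ballPackingNumber_le_card {G : Type*} [MetricSpace G] {X : Set G} {T : Finset G}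
    {ρ δ : ℝ} (hT : ∀ x ∈ X, ∃ p ∈ T, dist x p ≤ ρ) (hδ : 2 * ρ < δ) (hδ0 : 0 < δ) :
    ballPackingNumber X δ ≤ T.card := by
  refine iSup₂_le fun s hs => ?_
  choose f hfT hf using fun x : X => hT x x.2
  rw [← Set.encard_coe_eq_coe_finsetCard]
  refine Set.encard_le_encard_of_injOn (f := f) (fun x _ => hfT x) fun x hx y hy hxy => ?_
  by_contra hne
  refine Set.disjoint_left.1 (hs hx hy hne) (Metric.mem_ball_self hδ0) ?_
  rw [Metric.mem_ball, Subtype.dist_eq]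
  have h1 := hf x
  have h2 := hf y
  rw [hxy] at h1
  linarith [dist_triangle_right (x : G) y (f y)]

/-- In a maximal disjoint family, a point at distance at least `2 * δ` from all centres could be
added as a new centre. -/
theorem exists_encard_le_ballPackingNumber (Y : Type*) [MetricSpace Y] {δ : ℝ} (hδ : 0 < δ) :
    ∃ s : Set Y, s.encard ≤ ballPackingNumber Y δ ∧ ∀ y, ∃ z ∈ s, dist y z < 2 * δ := by
  obtain ⟨s, hs⟩ := zorn_subset {s : Set Y | s.PairwiseDisjoint fun x => Metric.ball x δ}
    fun c hc hchain => ⟨⋃₀ c,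
      (Set.pairwiseDisjoint_sUnion hchain.directedOn).2 fun _ ht => hc ht,
      fun _ => Set.subset_sUnion_of_mem⟩
  refine ⟨s, le_iSup₂_of_le s hs.prop le_rfl, fun y => ?_⟩
  by_contra! h
  have hys : y ∈ s := by
    refine hs.le_of_ge (y := insert y s) (hs.prop.insert fun z hz _ => ?_) (Set.subset_insert y s)
      (Set.mem_insert y s)
    exact Metric.ball_disjoint_ball (by linarith [h z hz])
  have := h y hys
  rw [dist_self] at this
  linarith

/-- Replacing both factors by centres moves a product by less than `4 * δ`, so `8 * δ`-separated
points receive distinct pairs of centres. -/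
theorem card_le_ballPackingNumber_sq {G : Type*} [Group G] [MetricSpace G]
    (hl : ∀ g x y : G, dist (g * x) (g * y) = dist x y)
    (hr : ∀ g x y : G, dist (x * g) (y * g) = dist x y) {X : Set G} (hX : X * X = Set.univ)
    {δ : ℝ} (hδ : 0 < δ) {S : Finset G} (hS : ∀ x ∈ S, ∀ y ∈ S, x ≠ y → 8 * δ ≤ dist x y) :
    (S.card : ℕ∞) ≤ ballPackingNumber X δ ^ 2 := by
  obtain ⟨Z, hZ, hZX⟩ := exists_encard_le_ballPackingNumber X hδ
  have hex : ∀ g : G, ∃ z : X × X, z ∈ Z ×ˢ Z ∧ dist g (z.1 * z.2) < 4 * δ := by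
    intro g
    obtain ⟨x, hx, y, hy, rfl⟩ := Set.mem_mul.1 (hX ▸ Set.mem_univ g)
    obtain ⟨z, hz, hxz⟩ := hZX ⟨x, hx⟩
    obtain ⟨w, hw, hyw⟩ := hZX ⟨y, hy⟩
    refine ⟨(z, w), ⟨hz, hw⟩, ?_⟩
    rw [Subtype.dist_eq, ← hr y] at hxz
    rw [Subtype.dist_eq, ← hl z] at hyw
    linarith [dist_triangle (x * y) (z * y) (z * w : G)]
  choose f hfZ hf using hex
  calc (S.card : ℕ∞) = (S : Set G).encard := (Set.encard_coe_eq_coe_finsetCard S).symm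
    _ ≤ (Z ×ˢ Z).encard := by
      refine Set.encard_le_encard_of_injOn (f := f) (fun x _ => hfZ x) fun x hx y hy hxy => ?_
      by_contra hne
      have h1 := hf x
      have h2 := hf y
      rw [hxy] at h1
      linarith [dist_triangle_right x y ((f y).1 * (f y).2 : G), hS x hx y hy hne]
    _ = Z.encard * Z.encard := Set.encard_prod
    _ ≤ _ := by rw [sq]; gcongr

/-! ### From counting bounds to the limsup. -/

theorem neg_log_div_log_eq {N : ℝ≥0∞} {δ : ℝ} :
    -(ENNReal.log N) / ((Real.log δ : ℝ) : EReal) = ENNReal.log N / ((-Real.log δ : ℝ) : EReal) := by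
  rw [EReal.div_eq_inv_mul, EReal.div_eq_inv_mul, EReal.coe_neg, EReal.inv_neg, mul_neg, neg_mul]

theorem ennreal_log_natCast {c : ℕ} (hc : c ≠ 0) :
    ENNReal.log (c : ℝ≥0∞) = ((Real.log c : ℝ) : EReal) := by
  rw [ENNReal.log_pos_real (by simpa using hc) (ENNReal.natCast_ne_top c), ENNReal.toReal_natCast]

theorem neg_log_div_log_le {N : ℕ∞} {c : ℕ} (hN : N ≤ c) (hc : c ≠ 0) {δ : ℝ} (hδ : 0 < δ)
    (hδ1 : δ < 1) :
    -(ENNReal.log (N : ℝ≥0∞)) / ((Real.log δ : ℝ) : EReal) ≤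
      ((Real.log c / -Real.log δ : ℝ) : EReal) := by
  have hN' : (N : ℝ≥0∞) ≤ ((c : ℕ∞) : ℝ≥0∞) := ENat.toENNReal_le.2 hN
  rw [neg_log_div_log_eq, EReal.coe_div, ← ennreal_log_natCast hc]
  refine EReal.div_le_div_right_of_nonneg ?_ (ENNReal.log_le_log (by simpa using hN'))
  exact_mod_cast (neg_nonneg.2 (Real.log_neg hδ hδ1).le)

theorem le_neg_log_div_log {N : ℕ∞} {c : ℕ} (hN : (c : ℕ∞) ≤ N ^ 2) (hc : c ≠ 0) {δ : ℝ}
    (hδ : 0 < δ) (hδ1 : δ < 1) :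
    ((Real.log c / 2 / -Real.log δ : ℝ) : EReal) ≤
      -(ENNReal.log (N : ℝ≥0∞)) / ((Real.log δ : ℝ) : EReal) := by
  rw [neg_log_div_log_eq, EReal.coe_div]
  refine EReal.div_le_div_right_of_nonneg
    (by exact_mod_cast (neg_nonneg.2 (Real.log_neg hδ hδ1).le)) ?_
  induction N using ENat.recTopCoe with
  | top => simp
  | coe m =>
    have hm : c ≤ m ^ 2 := by exact_mod_cast hN
    have hm0 : m ≠ 0 := by rintro rfl; simp at hm; exact hc hm
    rw [ENat.toENNReal_coe, ennreal_log_natCast hm0, EReal.coe_le_coe_iff]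
    have : Real.log c ≤ Real.log ((m : ℝ) ^ 2) :=
      Real.log_le_log (by exact_mod_cast Nat.pos_of_ne_zero hc) (by exact_mod_cast hm)
    rw [Real.log_pow] at this
    push_cast at this
    linarith

theorem tendsto_quadratic_div_quadratic (a b c d e : ℝ) (he : e ≠ 0) :
    Filter.Tendsto (fun m : ℕ => (a + m * b + m ^ 2 * c) / (d + m ^ 2 * e))
      Filter.atTop (𝓝 (c / e)) := by
  have hf : ContinuousAt (fun x : ℝ => (a * x ^ 2 + x * b + c) /
      (d * x ^ 2 + e)) 0 :=
    ContinuousAt.div (by fun_prop) (by fun_prop) (by simpa using he)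
  have h := hf.tendsto.comp (tendsto_inv_atTop_nhds_zero_nat (𝕜 := ℝ))
  simp only [ne_eq, OfNat.ofNat_ne_zero, not_false_eq_true, zero_pow, mul_zero, add_zero, zero_mul,
    zero_add] at h
  refine h.congr' ?_
  filter_upwards [Filter.eventually_ge_atTop 1] with m hm
  have hm0 : (m : ℝ) ≠ 0 := by positivity
  simp only [Function.comp]
  rw [← mul_div_mul_right _ _ (pow_ne_zero 2 hm0)]
  congr 1 <;> field_simp

theorem upperMinkowskiDim_le_of_ballPackingNumber_le {Y : Type*} [MetricSpace Y]
    {q n A D M : ℕ} (hq : 1 < q)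
    (h : ∀ (m : ℕ) (δ : ℝ), 4 * (q : ℝ)⁻¹ ^ (M + 2 * m ^ 2) < δ →
      ballPackingNumber Y δ ≤ (D * A ^ m * q ^ (n * m ^ 2) : ℕ)) :
    upperMinkowskiDim Y ≤ (((n : ℝ) / 2 : ℝ) : EReal) := by
  have hq1 : (1 : ℝ) < q := by exact_mod_cast hq
  have hq0 : (0 : ℝ) < q := by positivity
  have hlq := Real.log_pos hq1
  let ε : ℕ → ℝ := fun m => 4 * (q : ℝ)⁻¹ ^ (M + 2 * m ^ 2)
  have hε0 : ∀ m, 0 < ε m := fun m => by positivity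
  have hεlog : ∀ m, -Real.log (ε m)
      = (M * Real.log q - Real.log 4) + m ^ 2 * (2 * Real.log q) := by
    intro m
    rw [Real.log_mul (by norm_num) (by positivity), Real.log_pow, Real.log_inv]
    push_cast; ring
  have hεlim : Filter.Tendsto ε Filter.atTop (𝓝 0) := by
    have := (tendsto_pow_atTop_nhds_zero_of_lt_one (by positivity)
      (inv_lt_one_of_one_lt₀ hq1)).comp (f := fun m : ℕ => M + 2 * m ^ 2)
      (Filter.tendsto_atTop_mono (fun m => (Nat.le_self_pow two_ne_zero m).trans (by omega))
        Filter.tendsto_id)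
    simpa [ε] using this.const_mul 4
  -- The added ones keep the logarithms meaningful when `A` or `D` is 0.
  let c : ℕ → ℕ := fun m => (D + 1) * (A + 1) ^ m * q ^ (n * m ^ 2)
  have hc0 : ∀ m, c m ≠ 0 := fun m => by positivity
  have hclog : ∀ m, Real.log (c m)
      = Real.log (D + 1) + m * Real.log (A + 1) + m ^ 2 * (n * Real.log q) := by
    intro m
    simp only [c]
    push_cast
    rw [Real.log_mul (by positivity) (by positivity), Real.log_mul (by positivity) (by positivity),
      Real.log_pow, Real.log_pow]
    push_cast; ring
  -- For `ε (m + 1) < δ ≤ ε m` the count is bounded at the finer scale and `-log δ` at the coarser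
  -- one, hence the shifted index.
  have hlim : Filter.Tendsto (fun m => Real.log (c (m + 1)) / -Real.log (ε m)) Filter.atTop
      (𝓝 ((n : ℝ) / 2)) := by
    have := tendsto_quadratic_div_quadratic 
      (Real.log (D + 1) + Real.log (A + 1) + n * Real.log q)
      (Real.log (A + 1) + 2 * (n * Real.log q)) (n * Real.log q)
      (M * Real.log q - Real.log 4) (2 * Real.log q) (by positivity)
    rw [mul_div_mul_right _ _ hlq.ne'] at this
    refine this.congr fun m => ?_
    rw [hclog, hεlog]
    push_cast; ring
  refine EReal.le_of_forall_lt_iff_le.1 fun z hz => ?_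
  have hz' : (n : ℝ) / 2 < z := by exact_mod_cast hz
  obtain ⟨m₀, hm₀⟩ := Filter.eventually_atTop.1
    ((hlim.eventually_lt_const hz').and (hεlim.eventually_lt_const one_pos))
  refine Filter.limsup_le_of_le (by isBoundedDefault) ?_
  filter_upwards [Ioo_mem_nhdsGT (hε0 m₀)] with δ ⟨hδ0, hδ⟩
  obtain ⟨m, hm, hmδ, hδm⟩ : ∃ m, m₀ ≤ m ∧ ε (m + 1) < δ ∧ δ ≤ ε m := by
    classical
    have hex : ∃ m, ε m < δ := (hεlim.eventually_lt_const hδ0).exists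
    have hlt : m₀ < Nat.find hex := by
      rw [Nat.lt_find_iff]
      intro k hk
      refine not_lt.2 (hδ.le.trans ?_)
      simp only [ε]
      gcongr ?_ * ?_
      exact pow_le_pow_of_le_one (by positivity) (inv_le_one_of_one_le₀ hq1.le) (by gcongr)
    obtain ⟨m, hm⟩ : ∃ m, Nat.find hex = m + 1 := ⟨Nat.find hex - 1, by omega⟩
    exact ⟨m, by omega, hm ▸ Nat.find_spec hex, not_lt.1 (Nat.find_min hex (by omega))⟩
  have hδ1 : δ < 1 := hδm.trans_lt (hm₀ m hm).2
  have hcm : ballPackingNumber Y δ ≤ (c (m + 1) : ℕ) := (h (m + 1) δ hmδ).trans (by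
    simp only [c]
    gcongr <;> omega)
  refine (neg_log_div_log_le hcm (hc0 _) hδ0 hδ1).trans (EReal.coe_le_coe_iff.2 ?_)
  refine le_trans ?_ (hm₀ m hm).1.le
  have h1 : 0 < -Real.log (ε m) := neg_pos.2 (Real.log_neg (hε0 m) (hm₀ m hm).2)
  have h2 : 0 ≤ Real.log (c (m + 1)) := Real.log_natCast_nonneg _
  gcongr

theorem le_upperMinkowskiDim_of_le_ballPackingNumber_sq {Y : Type*} [MetricSpace Y]
    {q n M : ℕ} (hq : 1 < q)
    (h : ∀ k : ℕ, ((q ^ (n * k) : ℕ) : ℕ∞) ≤ ballPackingNumber Y ((q : ℝ)⁻¹ ^ (M + k) / 8) ^ 2) :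
    (((n : ℝ) / 2 : ℝ) : EReal) ≤ upperMinkowskiDim Y := by
  have hq1 : (1 : ℝ) < q := by exact_mod_cast hq
  have hq0 : (0 : ℝ) < q := by positivity
  have hlq := Real.log_pos hq1
  -- A limsup is bounded below along any sequence of scales; square exponents allow
  -- `tendsto_quadratic_div_quadratic` to be reused.
  let ε : ℕ → ℝ := fun k => (q : ℝ)⁻¹ ^ (M + k ^ 2) / 8
  have hε0 : ∀ k, 0 < ε k := fun k => by positivity
  have hε1 : ∀ k, ε k < 1 := fun k => by
    have : (q : ℝ)⁻¹ ^ (M + k ^ 2) ≤ 1 :=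
      pow_le_one₀ (by positivity) (inv_le_one_of_one_le₀ hq1.le)
    simp only [ε]; linarith
  have hεlim : Filter.Tendsto ε Filter.atTop (𝓝[>] 0) := by
    refine tendsto_nhdsWithin_iff.2 ⟨?_, Filter.Eventually.of_forall hε0⟩
    have := (tendsto_pow_atTop_nhds_zero_of_lt_one (by positivity)
      (inv_lt_one_of_one_lt₀ hq1)).comp (f := fun m : ℕ => M + m ^ 2)
      (Filter.tendsto_atTop_mono (fun m => (Nat.le_self_pow two_ne_zero m).trans (by omega))
        Filter.tendsto_id)
    simpa [ε] using this.div_const 8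
  refine EReal.ge_of_forall_gt_iff_ge.1 fun z hz => ?_
  have hz' : z < (n : ℝ) / 2 := by exact_mod_cast hz
  have hlim : Filter.Tendsto (fun k => Real.log ((q ^ (n * k ^ 2) : ℕ) : ℝ) / 2 / -Real.log (ε k))
      Filter.atTop (𝓝 ((n : ℝ) / 2)) := by
    have := tendsto_quadratic_div_quadratic 0 0 (n * Real.log q)
      (2 * (M * Real.log q + Real.log 8)) (2 * Real.log q) (by positivity)
    rw [mul_div_mul_right _ _ hlq.ne'] at this
    refine this.congr fun k => ?_
    rw [Real.log_div (by positivity) (by norm_num), Real.log_pow, Real.log_inv, div_div]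
    push_cast
    rw [Real.log_pow]
    push_cast
    congr 1 <;> ring
  refine Filter.le_limsup_of_frequently_le (hεlim.frequently
    (Filter.Eventually.frequently ?_)) (by isBoundedDefault)
  filter_upwards [hlim.eventually_const_lt hz'] with k hk
  exact (EReal.coe_le_coe_iff.2 hk.le).trans
    (le_neg_log_div_log (h (k ^ 2)) (by positivity) (hε0 k) (hε1 k))

/-! ### Both bounds combined, over any field with gridded line. -/

theorem IsCompatibleMetric.exists_mul_self_eq_univ_upperMinkowskiDim_eq {K E G : Type*}
    [NontriviallyNormedField K] [CompleteSpace K] [NormedAddCommGroup E] [NormedSpace K E]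
    [FiniteDimensional K E] [Group G] [MetricSpace G] [CompactSpace G] [ChartedSpace E G]
    {m : ℕ∞ω} (h : IsCompatibleMetric K E G m) {q : ℕ} (hq : 1 < q) (hK : IsGridded K q 1) :
    ∃ X : Set G, X * X = Set.univ ∧
      upperMinkowskiDim X = (((Module.finrank K E : ℝ) / 2 : ℝ) : EReal) := by
  have hG := h.isGriddedAt hq hK
  obtain ⟨X, hX, A, D, M, hT⟩ :=
    exists_mul_self_eq_univ_of_isGriddedAt h.left_invariant h.right_invariant hq hG
  refine ⟨X, hX, le_antisymm
    (upperMinkowskiDim_le_of_ballPackingNumber_le (A := A) (D := D) (M := M) hq fun k δ hδ => ?_) ?_⟩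
  · obtain ⟨T, hTc, hTX⟩ := hT k
    have hr0 : 0 < (q : ℝ)⁻¹ ^ (M + 2 * k ^ 2) := by positivity
    exact (ballPackingNumber_le_card hTX (by linarith) (by linarith)).trans (by exact_mod_cast hTc)
  · obtain ⟨M', hS⟩ := hG.exists_separated
    refine le_upperMinkowskiDim_of_le_ballPackingNumber_sq (M := M') hq fun k => ?_
    obtain ⟨S, hSc, hSs⟩ := hS k
    refine le_trans (by exact_mod_cast hSc) (card_le_ballPackingNumber_sq h.left_invariant
      h.right_invariant hX (by positivity) (S := S) fun x hx y hy hxy => ?_)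
    linarith [hSs x hx y hy hxy]
theorem theorem6p6 :
    (∀ (E : Type*) [NormedAddCommGroup E] [NormedSpace ℝ E] [FiniteDimensional ℝ E]
        (G : Type*) [Group G] [MetricSpace G] [CompactSpace G] [ChartedSpace E G]
        [LieGroup 𝓘(ℝ, E) ∞ G],
        IsCompatibleMetric ℝ E G ∞ →
          ∃ X : Set G, X * X = Set.univ ∧
            upperMinkowskiDim X = (((Module.finrank ℝ E : ℝ) / 2 : ℝ) : EReal)) ∧
    (∀ (p : ℕ) [Fact p.Prime]
        (E : Type*) [NormedAddCommGroup E] [NormedSpace ℚ_[p] E] [FiniteDimensional ℚ_[p] E]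
        (G : Type*) [Group G] [MetricSpace G] [CompactSpace G] [ChartedSpace E G]
        [LieGroup 𝓘(ℚ_[p], E) ω G],
        IsCompatibleMetric ℚ_[p] E G ω →
          ∃ X : Set G, X * X = Set.univ ∧
            upperMinkowskiDim X = (((Module.finrank ℚ_[p] E : ℝ) / 2 : ℝ) : EReal)) := by
  exact ⟨fun _ _ _ _ _ _ _ _ _ _ h =>
      h.exists_mul_self_eq_univ_upperMinkowskiDim_eq one_lt_two isGridded_real,
    fun p hp _ _ _ _ _ _ _ _ _ _ h =>
      h.exists_mul_self_eq_univ_upperMinkowskiDim_eq hp.out.one_lt (isGridded_padic p)⟩
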